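/- A partition $\pi$ of $[n]=\{1,\dots,n\}$ is represented by the graph on $[n]$ whose edges are the pairs $(i,j)$, $i<j$, such that $i$ and $j$ belong to the same block of $\pi$ and no element of that block lies strictly between them. Let $\mathrm{ed}(\pi)$ be the number of edges of $\pi$, let $\mathrm{cr}(\pi)$ be the number of crossings, i.e. of pairs of edges $(i_1,j_1),(i_2,j_2)$ with $i_1<i_2<j_1<j_2$, and let $\mathrm{ne}(\pi)$ be the number of nestings, i.e. of pairs of edges $(i_1,j_1),(i_2,j_2)$ with $i_1<i_2<j_2<j_1$. Let $\Pi_n$ be the set of partitions of $[n]$ and $$E_n(v,q)=\sum_{\pi\in\Pi_n}q^{\mathrm{cr}(\pi)+\mathrm{ne}(\pi)}\,v^{\mathrm{ed}(\pi)}\qquad(n\ge 0).$$ **Corollary.** Let $v,q$ be elements of a commutative ring (for example, indeterminates). As a formal power series in $z$, the generating function of the $E_n(v,q)$ has the J-fraction expansion $$\sum_{n\ge0}E_n(v,q)\,z^n=\cfrac{1}{1-z-\cfrac{v z^2}{1-(1+v)z-\cfrac{2qv z^2}{1-(1+2qv)z-\cfrac{3q^2v z^2}{1-(1+3q^2v)z-\cfrac{4q^3v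 z^2}{\ddots}}}}}$$ in which the denominator at level $k\ge0$ begins with $1-(1+kq^{k-1}v)z$ (which is $1-z$ for $k=0$) and the partial numerator between levels $k$ and $k+1$ is $(k+1)q^kv z^2$. Here the infinite continued fraction denotes the limit of its finite truncations in the sense of formal power series: for each $n$, the coefficient of $z^n$ in the truncation after level $m$ equals $E_n(v,q)$ for all sufficiently large $m$. -/

import Mathlib

open PowerSeries Filter

namespace SetPartition

/-- The set `Π_n` of partitions of `[n] = {1, …, n}` (into nonempty, pairwise disjoint blocks). -/
abbrev Part (n : ℕ) : Type := Finpartition (Finset.Icc 1 n)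

/-- The edges (arcs) of the graph of a set partition: the pairs `(i, j)` with `i < j` such that
`i` and `j` are consecutive elements of one block. -/
def edges {n : ℕ} (π : Part n) : Finset (ℕ × ℕ) :=
  (Finset.Icc 1 n ×ˢ Finset.Icc 1 n).filter fun e =>
    e.1 < e.2 ∧ ∃ B ∈ π.parts, e.1 ∈ B ∧ e.2 ∈ B ∧ ∀ k ∈ B, ¬ (e.1 < k ∧ k < e.2)

/-- `ed π`, the number of edges. -/
def ed {n : ℕ} (π : Part n) : ℕ := (edges π).card

/-- `cr π`, the number of crossings: pairs of edges `(i₁, j₁)`, `(i₂, j₂)` with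
`i₁ < i₂ < j₁ < j₂`. -/
def cr {n : ℕ} (π : Part n) : ℕ :=
  ((edges π ×ˢ edges π).filter fun p =>
    p.1.1 < p.2.1 ∧ p.2.1 < p.1.2 ∧ p.1.2 < p.2.2).card

/-- `ne π`, the number of nestings: pairs of edges `(i₁, j₁)`, `(i₂, j₂)` with
`i₁ < i₂ < j₂ < j₁`. -/
def ne {n : ℕ} (π : Part n) : ℕ :=
  ((edges π ×ˢ edges π).filter fun p =>
    p.1.1 < p.2.1 ∧ p.2.1 < p.2.2 ∧ p.2.2 < p.1.2).card

/-- `E_n(v, q) = ∑_{π ∈ Π_n} q ^ (cr π + ne π) * v ^ ed π`. -/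
def E {R : Type*} [CommRing R] (n : ℕ) (v q : R) : R :=
  ∑ π : Part n, q ^ (cr π + ne π) * v ^ ed π

end SetPartition

namespace JFraction

/-- The finite continued fraction with `m + 1` levels that starts at level `k`:
`1 / (1 - b k z - a k z² / (1 - b (k+1) z - a (k+1) z² / (⋯ / (1 - b (k+m) z))))`,
a formal power series in `z = X`. Every denominator has constant coefficient `1`, so it is
invertible, and `invOfUnit _ 1` is its inverse (see `denom_mul_conv`). -/
noncomputable def conv {R : Type*} [CommRing R] (b a : ℕ → R) : ℕ → ℕ → R⟦X⟧
  | 0, k => invOfUnit (1 - C (b k) * X) 1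
  | m + 1, k => invOfUnit (1 - C (b k) * X - C (a k) * X ^ 2 * conv b a m (k + 1)) 1

theorem denom_mul_conv_zero {R : Type*} [CommRing R] (b a : ℕ → R) (k : ℕ) :
    (1 - C (b k) * X) * conv b a 0 k = 1 := by
  rw [conv]
  exact mul_invOfUnit _ _ (by simp)

theorem denom_mul_conv {R : Type*} [CommRing R] (b a : ℕ → R) (m k : ℕ) :
    (1 - C (b k) * X - C (a k) * X ^ 2 * conv b a m (k + 1)) * conv b a (m + 1) k = 1 := by
  rw [conv]
  exact mul_invOfUnit _ _ (by simp)

/-- `F` is the value of the infinite J-fraction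
`1 / (1 - b 0 z - a 0 z² / (1 - b 1 z - a 1 z² / (1 - b 2 z - ⋯)))`: its convergents tend to `F`
in the `z`-adic sense, i.e. every coefficient is eventually that of `F`. -/
def HasJFraction {R : Type*} [CommRing R] (F : R⟦X⟧) (b a : ℕ → R) : Prop :=
  ∀ n : ℕ, ∀ᶠ m in atTop, coeff n (conv b a m 0) = coeff n F

end JFraction

/-! Scan the points from left to right and record the number of half-open arcs, opened but not yet
closed. By `cr_add_ne`, crossings plus nestings count the pairs of an arc and another one open when
it closes; the order of the two openers no longer matters. Hence, with k+1 half-open arcs, closing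
any one of them contributes the same factor q^k v, and there are k+1 choices. A new point may close
an arc and then, independently, open one. These half-steps are `total_succ_left` and
`total_succ_succ`, and because of them `states` bounds arcs and marked points separately. Together
they give the Motzkin recurrence with the required weights, which `hasJFraction_of_recurrence` turns
into the J-fraction. `E_eq_total` matches partitions with states having no half-open arc. -/

namespace JFraction

/-! ### Motzkin paths and J-fractions -/

variable {R : Type*} [CommRing R]

/-- The generating function of the weighted Motzkin paths of height at most `m` that end at
level `k`. -/
noncomputable def pathSeries (b a : ℕ → R) (m : ℕ) : ℕ → R⟦X⟧
  | 0 => conv b a m 0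
  -- Cut at the last up-step from `k` to `k + 1`: afterwards the path stays between levels `k + 1`
  -- and `m`.
  | k + 1 => X * pathSeries b a m k * conv b a (m - (k + 1)) (k + 1)

theorem conv_eq (b a : ℕ → R) (m k : ℕ) :
    conv b a (m + 1) k = 1 + X * (C (b k) * conv b a (m + 1) k +
      C (a k) * (X * conv b a (m + 1) k * conv b a m (k + 1))) := by
  linear_combination denom_mul_conv b a m k

theorem constantCoeff_conv (b a : ℕ → R) (m k : ℕ) : constantCoeff (conv b a m k) = 1 := by
  cases m <;> simp [conv]

theorem constantCoeff_pathSeries_zero (b a : ℕ → R) (m : ℕ) :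
    constantCoeff (pathSeries b a m 0) = 1 := constantCoeff_conv b a m 0

theorem constantCoeff_pathSeries_succ (b a : ℕ → R) (m k : ℕ) :
    constantCoeff (pathSeries b a m (k + 1)) = 0 := by
  simp [pathSeries]

theorem pathSeries_zero_eq (b a : ℕ → R) {m : ℕ} (hm : 0 < m) :
    pathSeries b a m 0 = 1 + X * (C (b 0) * pathSeries b a m 0 +
      C (a 0) * pathSeries b a m 1) := by
  obtain ⟨m, rfl⟩ := Nat.exists_eq_succ_of_ne_zero hm.ne'
  simpa [pathSeries] using conv_eq b a m 0

theorem pathSeries_succ_eq (b a : ℕ → R) {m k : ℕ} (hm : k + 1 < m) :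
    pathSeries b a m (k + 1) = X * (pathSeries b a m k +
      C (b (k + 1)) * pathSeries b a m (k + 1) + C (a (k + 1)) * pathSeries b a m (k + 2)) := by
  obtain ⟨d, rfl⟩ := Nat.exists_eq_add_of_lt hm
  have h1 : k + 1 + d + 1 - (k + 1) = d + 1 := by omega
  have h2 : k + 1 + d + 1 - (k + 1 + 1) = d := by omega
  simp only [pathSeries, h1, h2]
  linear_combination X * pathSeries b a (k + 1 + d + 1) k * conv_eq b a d (k + 1)

/-- If `f n k` is the weight of the Motzkin paths of length `n` that end at level `k`, then
`∑ n, f n 0 z ^ n` is the value of the J-fraction with the same weights. -/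
theorem hasJFraction_of_recurrence (b a : ℕ → R) (f : ℕ → ℕ → R)
    (h0 : f 0 0 = 1) (h0' : ∀ k, f 0 (k + 1) = 0)
    (hz : ∀ n, f (n + 1) 0 = b 0 * f n 0 + a 0 * f n 1)
    (hs : ∀ n k, f (n + 1) (k + 1) =
      f n k + b (k + 1) * f n (k + 1) + a (k + 1) * f n (k + 2)) :
    HasJFraction (mk fun n => f n 0) b a := by
  -- The recurrence lowers `n` by one and raises `k` by at most one, so the bound `n + k ≤ m`
  -- survives the induction and the truncation at height `m` is never felt.
  have key : ∀ m n k, n + k ≤ m → coeff n (pathSeries b a m k) = f n k := by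
    intro m n
    induction n with
    | zero =>
      intro k _
      cases k with
      | zero => simpa [h0] using constantCoeff_pathSeries_zero b a m
      | succ k => simpa [h0'] using constantCoeff_pathSeries_succ b a m k
    | succ n ih =>
      intro k hk
      cases k with
      | zero =>
        rw [pathSeries_zero_eq b a (by omega), hz, ← ih 0 (by omega), ← ih 1 (by omega)]
        simp [coeff_succ_X_mul, coeff_one]
      | succ k =>
        rw [pathSeries_succ_eq b a (by omega), hs, ← ih k (by omega), ← ih (k + 1) (by omega),
          ← ih (k + 2) (by omega)]
        simp [coeff_succ_X_mul]
  intro n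
  filter_upwards [eventually_ge_atTop n] with m hm
  simpa [pathSeries] using key m n 0 (by omega)

end JFraction

/-! ### Set partitions as arc sets -/

namespace SetPartition

/-- Sets of arcs `(i, j)`, `i < j`, on `[n]` in which every point opens at most one arc and closes
at most one arc. -/
structure IsArcSet (n : ℕ) (A : Finset (ℕ × ℕ)) : Prop where
  one_le : ∀ e ∈ A, 1 ≤ e.1
  lt : ∀ e ∈ A, e.1 < e.2
  le : ∀ e ∈ A, e.2 ≤ n
  fst_inj : ∀ e ∈ A, ∀ e' ∈ A, e.1 = e'.1 → e = e'
  snd_inj : ∀ e ∈ A, ∀ e' ∈ A, e.2 = e'.2 → e = e'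

theorem mem_edges {n : ℕ} {π : Part n} {i j : ℕ} :
    (i, j) ∈ edges π ↔ i < j ∧ j ∈ π.part i ∧ ∀ k ∈ π.part i, ¬ (i < k ∧ k < j) := by
  simp only [edges, Finset.mem_filter, Finset.mem_product]
  constructor
  · rintro ⟨_, hij, B, hB, hi, hj, hk⟩
    obtain rfl := π.part_eq_of_mem hB hi
    exact ⟨hij, hj, hk⟩
  · rintro ⟨hij, hj, hk⟩
    have hi : i ∈ Finset.Icc 1 n := π.part_nonempty.1 ⟨j, hj⟩
    have hB := π.part_mem.2 hi
    exact ⟨⟨hi, π.le hB hj⟩, hij, _, hB, π.mem_part hi, hj, hk⟩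

theorem isArcSet_edges {n : ℕ} (π : Part n) : IsArcSet n (edges π) where
  one_le e he := by
    simp only [edges, Finset.mem_filter, Finset.mem_product, Finset.mem_Icc] at he
    exact he.1.1.1
  lt e he := (mem_edges.1 he).1
  le e he := by
    simp only [edges, Finset.mem_filter, Finset.mem_product, Finset.mem_Icc] at he
    exact he.1.2.2
  fst_inj := by
    rintro ⟨i, j⟩ he ⟨i', j'⟩ he' (rfl : i = i')
    obtain ⟨h1, h2, h3⟩ := mem_edges.1 he
    obtain ⟨h1', h2', h3'⟩ := mem_edges.1 he'
    have := h3 _ h2'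
    have := h3' _ h2
    simp only [Prod.mk.injEq, true_and]
    omega
  snd_inj := by
    rintro ⟨i, j⟩ he ⟨i', j'⟩ he' (rfl : j = j')
    obtain ⟨h1, h2, h3⟩ := mem_edges.1 he
    obtain ⟨h1', h2', h3'⟩ := mem_edges.1 he'
    have hi : i ∈ Finset.Icc 1 n := π.part_nonempty.1 ⟨j, h2⟩
    have hi' : i' ∈ Finset.Icc 1 n := π.part_nonempty.1 ⟨j, h2'⟩
    have hp : π.part i = π.part i' :=
      π.eq_of_mem_parts (π.part_mem.2 hi) (π.part_mem.2 hi') h2 h2'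
    have := h3 i' (hp ▸ π.mem_part hi')
    have := h3' i (hp ▸ π.mem_part hi)
    simp only [Prod.mk.injEq, and_true]
    omega

/-- Walk along the block from each element to the next one: every such step is an edge of `π`, hence
of `π'`. -/
theorem mem_part_of_edges_subset {n : ℕ} {π π' : Part n} (h : edges π ⊆ edges π') {i : ℕ}
    (hi : i ∈ Finset.Icc 1 n) (d : ℕ) : i + d ∈ π.part i → i + d ∈ π'.part i := by
  induction d using Nat.strong_induction_on generalizing i with
  | _ d ih =>
  intro hd
  rcases Nat.eq_zero_or_pos d with rfl | hpos
  · simpa using hi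
  have hne : ((π.part i).filter (i < ·)).Nonempty := ⟨i + d, by simp [hd, hpos]⟩
  set k := ((π.part i).filter (i < ·)).min' hne with hk
  obtain ⟨hki, hik⟩ := Finset.mem_filter.1 (Finset.min'_mem _ hne)
  rw [← hk] at hki hik
  have hkd : k ≤ i + d := Finset.min'_le _ _ (by simp [hd, hpos])
  have hedge : (i, k) ∈ edges π := mem_edges.2 ⟨hik, hki, fun l hl hl' =>
    (Finset.min'_le _ l (Finset.mem_filter.2 ⟨hl, hl'.1⟩)).not_gt (hk ▸ hl'.2)⟩
  have hk' := (mem_edges.1 (h hedge)).2.1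
  have hkn : k ∈ Finset.Icc 1 n := π.le (π.part_mem.2 hi) hki
  have hpk : π.part k = π.part i := π.part_eq_of_mem (π.part_mem.2 hi) hki
  have hpk' : π'.part k = π'.part i := π'.part_eq_of_mem (π'.part_mem.2 hi) hk'
  obtain ⟨c, hc⟩ := Nat.exists_eq_add_of_le hkd
  have := ih c (by omega) hkn (by rw [← hc, hpk]; exact hd)
  rwa [← hc, hpk'] at this

theorem le_of_edges_subset {n : ℕ} {π π' : Part n} (h : edges π ⊆ edges π') : π ≤ π' := by
  intro B hB
  have hne := π.nonempty_of_mem_parts hB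
  set i := B.min' hne
  have hiB : i ∈ B := B.min'_mem hne
  have hi : i ∈ Finset.Icc 1 n := π.le hB hiB
  refine ⟨π'.part i, π'.part_mem.2 hi, fun j hj => ?_⟩
  obtain ⟨d, hd⟩ := Nat.exists_eq_add_of_le (B.min'_le j hj)
  rw [hd] at hj ⊢
  exact mem_part_of_edges_subset h hi d (by rwa [π.part_eq_of_mem hB hiB])

theorem edges_injective {n : ℕ} : Function.Injective (edges (n := n)) := fun _ _ h =>
  le_antisymm (le_of_edges_subset h.le) (le_of_edges_subset h.ge)

open Classical in
/-- The least point from which `j` can be reached along the arcs of `A`. -/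
noncomputable def root (A : Finset (ℕ × ℕ)) (j : ℕ) : ℕ :=
  if h : ∃ i, i < j ∧ (i, j) ∈ A then root A h.choose else j
termination_by j
decreasing_by exact h.choose_spec.1

theorem root_eq_self {A : Finset (ℕ × ℕ)} {j : ℕ} (h : ∀ i, i < j → (i, j) ∉ A) :
    root A j = j := by
  rw [root, dif_neg (by simpa using h)]

theorem root_le (A : Finset (ℕ × ℕ)) (j : ℕ) : root A j ≤ j := by
  induction j using Nat.strong_induction_on with
  | _ j ih =>
  rw [root]
  split_ifs with h
  · exact (ih _ h.choose_spec.1).trans h.choose_spec.1.le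
  · exact le_rfl

namespace IsArcSet

variable {n : ℕ} {A : Finset (ℕ × ℕ)}

theorem root_eq (hA : IsArcSet n A) {i j : ℕ} (h : (i, j) ∈ A) : root A j = root A i := by
  have hex : ∃ i, i < j ∧ (i, j) ∈ A := ⟨i, hA.lt _ h, h⟩
  have hc : hex.choose = i := congrArg Prod.fst (hA.snd_inj _ hex.choose_spec.2 _ h rfl)
  rw [root, dif_pos hex, hc]

theorem le_of_reflTransGen (hA : IsArcSet n A) {i j : ℕ}
    (h : Relation.ReflTransGen (fun a b => (a, b) ∈ A) i j) : i ≤ j := by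
  induction h with
  | refl => exact le_rfl
  | tail _ h ih => exact ih.trans (hA.lt _ h).le

theorem root_eq_of_reflTransGen (hA : IsArcSet n A) {i j : ℕ}
    (h : Relation.ReflTransGen (fun a b => (a, b) ∈ A) i j) : root A i = root A j := by
  induction h with
  | refl => rfl
  | tail _ h ih => exact ih.trans (hA.root_eq h).symm

/-- Of two points of one component, the smaller is joined to the larger by a chain of arcs. -/
theorem reflTransGen_of_root_eq (hA : IsArcSet n A) {i j : ℕ} (hij : i ≤ j)
    (h : root A i = root A j) : Relation.ReflTransGen (fun a b => (a, b) ∈ A) i j := by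
  induction j using Nat.strong_induction_on generalizing i with
  | _ j ih =>
  rcases hij.eq_or_lt with rfl | hij
  · exact .refl
  by_cases hex : ∃ p, p < j ∧ (p, j) ∈ A
  · obtain ⟨p, hpj, hp⟩ := hex
    rcases le_or_gt i p with hip | hpi
    · exact (ih p hpj hip (by rw [h, hA.root_eq hp])).tail hp
    -- A chain from `p` to `i` would have to start with the only arc leaving `p`, which ends at `j >
    -- i`.
    · have hch := ih i hij hpi.le (by rw [h, hA.root_eq hp])
      rcases hch.cases_head with rfl | ⟨c, hc, hci⟩
      · exact absurd hpi (lt_irrefl _)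
      · have hcj : c = j := congrArg Prod.snd (hA.fst_inj _ hc _ hp rfl)
        have := hA.le_of_reflTransGen hci
        omega
  · push Not at hex
    have := root_le A i
    rw [h, root_eq_self hex] at this
    omega

open Classical in
/-- The set partition whose blocks are the components of an arc set. -/
noncomputable def _root_.SetPartition.components (n : ℕ) (A : Finset (ℕ × ℕ)) : Part n :=
  Finpartition.ofSetSetoid (Setoid.ker (root A)) (Finset.Icc 1 n)

theorem mem_part_components {i j : ℕ} : j ∈ (components n A).part i ↔
    i ∈ Finset.Icc 1 n ∧ j ∈ Finset.Icc 1 n ∧ root A i = root A j := by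
  classical
  exact Finpartition.mem_part_ofSetSetoid_iff_rel _

theorem edges_components (hA : IsArcSet n A) : edges (components n A) = A := by
  ext ⟨i, j⟩
  simp only [mem_edges, mem_part_components, Finset.mem_Icc]
  constructor
  · rintro ⟨hij, ⟨hi, hj, hr⟩, hk⟩
    rcases (hA.reflTransGen_of_root_eq hij.le hr).cases_tail with rfl | ⟨p, hp, hpj⟩
    · exact absurd hij (lt_irrefl _)
    · have hip := hA.le_of_reflTransGen hp
      have hlt := hA.lt _ hpj
      rcases hip.eq_or_lt with rfl | hip
      · exact hpj
      · exact absurd ⟨hip, hlt⟩ (hk p ⟨hi, ⟨by omega, by omega⟩, hA.root_eq_of_reflTransGen hp⟩)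
  · intro h
    have h1 := hA.one_le _ h
    have h2 := hA.lt _ h
    have h3 := hA.le _ h
    dsimp only at h1 h2 h3
    refine ⟨h2, ⟨⟨h1, by omega⟩, ⟨by omega, h3⟩, (hA.root_eq h).symm⟩, ?_⟩
    rintro k ⟨_, _, hk⟩ ⟨hik, hkj⟩
    rcases (hA.reflTransGen_of_root_eq hik.le hk).cases_head with rfl | ⟨c, hc, hck⟩
    · exact lt_irrefl _ hik
    · have hcj : c = j := congrArg Prod.snd (hA.fst_inj _ hc _ h rfl)
      have := hA.le_of_reflTransGen hck
      omega

end IsArcSet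

/-! ### Weighted arc sets with half-open arcs -/

/-- The number of pairs consisting of an arc `e` and of another arc, or a half-open arc from a
point of `S`, that is open when `e` is closed. -/
def cover (A : Finset (ℕ × ℕ)) (S : Finset ℕ) : ℕ :=
  ((A ×ˢ A).filter fun p => p.2.1 < p.1.2 ∧ p.1.2 < p.2.2).card +
    ((A ×ˢ S).filter fun p => p.2 < p.1.2).card

theorem cr_add_ne {n : ℕ} (π : Part n) : cr π + ne π = cover (edges π) ∅ := by
  have hA := isArcSet_edges π
  -- Swap each nesting so that, as in a crossing, the arc closing first comes first.
  have hne : ne π = ((edges π ×ˢ edges π).filter fun p =>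
      p.2.1 < p.1.1 ∧ p.1.1 < p.1.2 ∧ p.1.2 < p.2.2).card :=
    Finset.card_nbij' Prod.swap Prod.swap (by intro p; simp; tauto) (by intro p; simp; tauto)
      (by simp [Set.LeftInvOn]) (by simp [Set.LeftInvOn])
  rw [hne, cr, cover, ← Finset.card_union_of_disjoint, ← Finset.filter_or]
  · simp only [Finset.product_empty, Finset.filter_empty, Finset.card_empty, add_zero]
    congr 1
    refine Finset.filter_congr ?_
    rintro ⟨e, e'⟩ he
    obtain ⟨he, he'⟩ := Finset.mem_product.1 he
    have h1 := hA.lt _ he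
    have h2 : e.1 = e'.1 → e.2 = e'.2 := fun h => congrArg Prod.snd (hA.fst_inj _ he _ he' h)
    dsimp only at h1 h2 ⊢
    omega
  · refine Finset.disjoint_filter.2 ?_
    rintro ⟨e, e'⟩ _
    dsimp only
    omega

open Classical in
/-- The arc sets with arcs on `[m]`, together with `k` points of `[n]` that open no arc. -/
noncomputable def states (m n k : ℕ) : Finset (Finset (ℕ × ℕ) × Finset ℕ) :=
  ((Finset.Icc 1 m ×ˢ Finset.Icc 1 m).powerset ×ˢ (Finset.Icc 1 n).powersetCard k).filter
    fun p => IsArcSet m p.1 ∧ ∀ e ∈ p.1, e.1 ∉ p.2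

theorem mem_states {m n k : ℕ} {p : Finset (ℕ × ℕ) × Finset ℕ} : p ∈ states m n k ↔
    IsArcSet m p.1 ∧ p.2 ⊆ Finset.Icc 1 n ∧ p.2.card = k ∧ ∀ e ∈ p.1, e.1 ∉ p.2 := by
  simp only [states, Finset.mem_filter, Finset.mem_product, Finset.mem_powerset,
    Finset.mem_powersetCard]
  constructor
  · tauto
  · rintro ⟨hA, h⟩
    refine ⟨⟨fun e he => ?_, h.1, h.2.1⟩, hA, h.2.2⟩
    have h1 := hA.one_le _ he
    have h2 := hA.lt _ he
    have h3 := hA.le _ he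
    simp only [Finset.mem_product, Finset.mem_Icc]
    omega

variable {R : Type*} [CommRing R]

/-- The weight `q ^ cover A S * v ^ |A|` of an arc set with marked points. -/
def weight (v q : R) (p : Finset (ℕ × ℕ) × Finset ℕ) : R := q ^ cover p.1 p.2 * v ^ p.1.card

/-- The total weight of `states m n k`. -/
noncomputable def total (v q : R) (m n k : ℕ) : R := ∑ p ∈ states m n k, weight v q p

theorem E_eq_total (v q : R) (n : ℕ) : E n v q = total v q n n 0 := by
  rw [E, total]
  refine Finset.sum_bij (fun π _ => (edges π, ∅)) ?_ ?_ ?_ ?_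
  · intro π _
    simp [mem_states, isArcSet_edges]
  · intro π _ π' _ h
    exact edges_injective (congrArg Prod.fst h)
  · rintro ⟨A, S⟩ h
    obtain ⟨hA, -, hS, -⟩ := mem_states.1 h
    obtain rfl := Finset.card_eq_zero.1 hS
    exact ⟨components n A, Finset.mem_univ _, by rw [hA.edges_components]⟩
  · intro π _
    rw [weight, cr_add_ne, ed]

end SetPartition

/-! ### Recurrence on adding a last point -/

namespace SetPartition

theorem cover_eq_sum (A : Finset (ℕ × ℕ)) (S : Finset ℕ) : cover A S =
    (∑ e ∈ A, ∑ e' ∈ A, if e'.1 < e.2 ∧ e.2 < e'.2 then 1 else 0) +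
      ∑ e ∈ A, ∑ s ∈ S, if s < e.2 then 1 else 0 := by
  rw [cover, Finset.card_filter, Finset.card_filter, Finset.sum_product, Finset.sum_product]

/-- A half-open arc starting at or after every closer is open at none of them. -/
theorem cover_insert_right {A : Finset (ℕ × ℕ)} {S : Finset ℕ} {s : ℕ}
    (hA : ∀ e ∈ A, e.2 ≤ s) : cover A (insert s S) = cover A S := by
  by_cases hs : s ∈ S
  · rw [Finset.insert_eq_of_mem hs]
  rw [cover_eq_sum, cover_eq_sum]
  congr 1
  refine Finset.sum_congr rfl fun e he => ?_
  rw [Finset.sum_insert hs, if_neg (hA e he).not_gt, zero_add]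

/-- Closing the half-open arc from `i` at a new last point. -/
theorem cover_insert_left {A : Finset (ℕ × ℕ)} {S : Finset ℕ} {i n : ℕ}
    (hA : ∀ e ∈ A, e.2 ≤ n) (hi : i ∉ S) (hS : ∀ s ∈ S, s ≤ n) :
    cover (insert (i, n + 1) A) S = cover A (insert i S) + S.card := by
  have hnew : (i, n + 1) ∉ A := fun h => by simpa using hA _ h
  rw [cover_eq_sum, cover_eq_sum]
  simp only [Finset.sum_insert hnew, Finset.sum_insert hi, Finset.sum_add_distrib]
  -- At `n + 1` no old arc is still open (`h1`), while all of `S` is (`h3`). At earlier closers the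
  -- new arc counts just as the half-open arc from `i` did (`h2`).
  have h1 : ∑ e' ∈ A, (if e'.1 < n + 1 ∧ n + 1 < e'.2 then 1 else 0) = 0 :=
    Finset.sum_eq_zero fun e he => if_neg (by have := hA e he; omega)
  have h2 : ∑ e ∈ A, (if i < e.2 ∧ e.2 < n + 1 then 1 else 0) =
      ∑ e ∈ A, if i < e.2 then 1 else 0 :=
    Finset.sum_congr rfl fun e he => by
      have := hA e he
      exact if_congr (by omega) rfl rfl
  have h3 : ∑ s ∈ S, (if s < n + 1 then 1 else 0) = S.card := by
    rw [Finset.card_eq_sum_ones]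
    exact Finset.sum_congr rfl fun s hs => if_pos (by have := hS s hs; omega)
  rw [h1, h2, h3, if_neg (by simp)]
  ring

theorem isArcSet_succ_iff {n : ℕ} {A : Finset (ℕ × ℕ)} :
    (IsArcSet (n + 1) A ∧ ∀ e ∈ A, e.2 ≠ n + 1) ↔ IsArcSet n A := by
  constructor
  · rintro ⟨h, hn⟩
    exact ⟨h.one_le, h.lt, fun e he => by have := h.le e he; have := hn e he; omega,
      h.fst_inj, h.snd_inj⟩
  · intro h
    refine ⟨⟨h.one_le, h.lt, fun e he => ?_, h.fst_inj, h.snd_inj⟩, fun e he => ?_⟩ <;>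
    · have := h.le e he
      omega

theorem IsArcSet.insert {n i : ℕ} {A : Finset (ℕ × ℕ)} (hA : IsArcSet n A) (hi : 1 ≤ i)
    (hin : i ≤ n) (hiA : ∀ e ∈ A, e.1 ≠ i) : IsArcSet (n + 1) (insert (i, n + 1) A) where
  one_le := Finset.forall_mem_insert .. |>.2 ⟨hi, hA.one_le⟩
  lt := Finset.forall_mem_insert .. |>.2 ⟨Nat.lt_succ_of_le hin, hA.lt⟩
  le := Finset.forall_mem_insert .. |>.2 ⟨le_rfl, fun e he => (hA.le e he).trans n.le_succ⟩
  fst_inj := by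
    intro e he e' he' h
    rcases Finset.mem_insert.1 he with rfl | he <;> rcases Finset.mem_insert.1 he' with rfl | he'
    · rfl
    · exact absurd h.symm (hiA e' he')
    · exact absurd h (hiA e he)
    · exact hA.fst_inj e he e' he' h
  snd_inj := by
    intro e he e' he' h
    rcases Finset.mem_insert.1 he with rfl | he <;> rcases Finset.mem_insert.1 he' with rfl | he'
    · rfl
    · have := hA.le e' he'
      dsimp only at h
      omega
    · have := hA.le e he
      dsimp only at h
      omega
    · exact hA.snd_inj e he e' he' h

theorem IsArcSet.subset {n : ℕ} {A B : Finset (ℕ × ℕ)} (hA : IsArcSet n A) (h : B ⊆ A) :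
    IsArcSet n B :=
  ⟨fun e he => hA.one_le e (h he), fun e he => hA.lt e (h he), fun e he => hA.le e (h he),
    fun e he e' he' => hA.fst_inj e (h he) e' (h he'),
    fun e he e' he' => hA.snd_inj e (h he) e' (h he')⟩

theorem states_succ_not_mem (n k : ℕ) :
    (states (n + 1) (n + 1) k).filter (fun p => n + 1 ∉ p.2) = states (n + 1) n k := by
  ext ⟨A, S⟩
  simp only [Finset.mem_filter, mem_states]
  constructor
  · rintro ⟨⟨hA, hS, hk, hAS⟩, hn⟩
    refine ⟨hA, fun s hs => ?_, hk, hAS⟩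
    have h1 := Finset.mem_Icc.1 (hS hs)
    have h2 : s ≠ n + 1 := fun h => hn (h ▸ hs)
    exact Finset.mem_Icc.2 (by omega)
  · rintro ⟨hA, hS, hk, hAS⟩
    refine ⟨⟨hA, hS.trans (Finset.Icc_subset_Icc_right n.le_succ), hk, hAS⟩, fun h => ?_⟩
    simpa using hS h

theorem states_succ_no_arc (n k : ℕ) :
    (states (n + 1) n k).filter (fun p => ∀ e ∈ p.1, e.2 ≠ n + 1) = states n n k := by
  ext ⟨A, S⟩
  simp only [Finset.mem_filter, mem_states, ← isArcSet_succ_iff (n := n)]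
  tauto

variable {R : Type*} [CommRing R]

theorem total_zero (v q : R) : total v q 0 0 0 = 1 := by
  have : states 0 0 0 = {(∅, ∅)} := by
    ext ⟨A, S⟩
    simp only [mem_states, Finset.mem_singleton, Prod.mk.injEq]
    constructor
    · rintro ⟨hA, -, hS, -⟩
      refine ⟨Finset.eq_empty_of_forall_notMem fun e he => ?_, Finset.card_eq_zero.1 hS⟩
      have := hA.lt e he
      have := hA.le e he
      omega
    · rintro ⟨rfl, rfl⟩
      exact ⟨⟨by simp, by simp, by simp, by simp, by simp⟩, by simp⟩
  simp [total, this, weight, cover]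

theorem total_zero_succ (v q : R) (k : ℕ) : total v q 0 0 (k + 1) = 0 := by
  refine Finset.sum_eq_zero ?_
  rintro ⟨A, S⟩ h
  obtain ⟨-, hS, hk, -⟩ := mem_states.1 h
  have : S = ∅ := by simpa using hS
  simp [this] at hk

theorem total_succ_zero (v q : R) (n : ℕ) :
    total v q (n + 1) (n + 1) 0 = total v q (n + 1) n 0 := by
  rw [total, total, ← states_succ_not_mem, Finset.filter_true_of_mem]
  intro p hp
  simp [Finset.card_eq_zero.1 (mem_states.1 hp).2.2.1]

/-- The last point may be made the origin of a half-open arc, or not. -/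
theorem total_succ_succ (v q : R) (n k : ℕ) : total v q (n + 1) (n + 1) (k + 1) =
    total v q (n + 1) n k + total v q (n + 1) n (k + 1) := by
  classical
  rw [total, ← Finset.sum_filter_add_sum_filter_not _ fun p => n + 1 ∈ p.2, states_succ_not_mem,
    ← total, total]
  congr 1
  symm
  refine Finset.sum_bij (fun p _ => (p.1, insert (n + 1) p.2)) ?_ ?_ ?_ ?_
  · rintro ⟨A, S⟩ h
    obtain ⟨hA, hS, hk, hAS⟩ := mem_states.1 h
    have hn : n + 1 ∉ S := fun h => by simpa using hS h
    refine Finset.mem_filter.2 ⟨mem_states.2 ⟨hA, ?_, ?_, ?_⟩, Finset.mem_insert_self _ _⟩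
    · exact Finset.insert_subset (by simp) (hS.trans (Finset.Icc_subset_Icc_right n.le_succ))
    · rw [Finset.card_insert_of_notMem hn]
      exact congrArg (· + 1) hk
    · intro e he h
      have := hA.lt e he
      have := hA.le e he
      rcases Finset.mem_insert.1 h with h | h
      · omega
      · exact hAS e he h
  · rintro ⟨A, S⟩ h ⟨A', S'⟩ h' heq
    have hn : n + 1 ∉ S := fun hs => by simpa using (mem_states.1 h).2.1 hs
    have hn' : n + 1 ∉ S' := fun hs => by simpa using (mem_states.1 h').2.1 hs
    obtain ⟨rfl, heq⟩ := Prod.mk.inj heq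
    dsimp only at heq
    rw [← Finset.erase_insert hn, heq, Finset.erase_insert hn']
  · rintro ⟨A, S⟩ h
    obtain ⟨h, hn⟩ := Finset.mem_filter.1 h
    obtain ⟨hA, hS, hk, hAS⟩ := mem_states.1 h
    refine ⟨(A, S.erase (n + 1)), ?_, by simp [Finset.insert_erase hn]⟩
    rw [← states_succ_not_mem]
    refine Finset.mem_filter.2 ⟨mem_states.2 ⟨hA, (Finset.erase_subset _ _).trans hS, ?_, ?_⟩,
      Finset.notMem_erase _ _⟩
    · rw [Finset.card_erase_of_mem hn]
      exact Nat.sub_eq_of_eq_add hk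
    · exact fun e he h => hAS e he (Finset.mem_of_mem_erase h)
  · rintro ⟨A, S⟩ h
    rw [weight, weight, cover_insert_right (mem_states.1 h).1.le]

/-- The last point may close one of the half-open arcs, or none. -/
theorem total_succ_left (v q : R) (n k : ℕ) : total v q (n + 1) n k =
    total v q n n k + (k + 1) * q ^ k * v * total v q n n (k + 1) := by
  classical
  rw [total, ← Finset.sum_filter_add_sum_filter_not _ fun p => ∀ e ∈ p.1, e.2 ≠ n + 1,
    states_succ_no_arc, ← total]
  congr 1
  -- The factor `k + 1` becomes a choice of the marked point whose arc is to be closed.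
  have hsum : (k + 1) * q ^ k * v * total v q n n (k + 1) =
      ∑ x ∈ (states n n (k + 1)).sigma fun p => p.2, q ^ k * v * weight v q x.1 := by
    rw [total, Finset.sum_sigma, Finset.mul_sum]
    refine Finset.sum_congr rfl fun p hp => ?_
    dsimp only
    rw [Finset.sum_const, (mem_states.1 hp).2.2.1, nsmul_eq_mul]
    push_cast
    ring
  rw [hsum]
  symm
  refine Finset.sum_bij (fun x _ => (insert (x.2, n + 1) x.1.1, x.1.2.erase x.2)) ?_ ?_ ?_ ?_
  · rintro ⟨⟨A, S⟩, i⟩ h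
    obtain ⟨h, hi⟩ := Finset.mem_sigma.1 h
    obtain ⟨hA, hS, hk, hAS⟩ := mem_states.1 h
    dsimp only at hA hS hk hAS hi ⊢
    have hin := Finset.mem_Icc.1 (hS hi)
    refine Finset.mem_filter.2 ⟨mem_states.2 ⟨?_, (Finset.erase_subset _ _).trans hS, ?_, ?_⟩, ?_⟩
    · exact hA.insert hin.1 hin.2 fun e he h => hAS e he (h ▸ hi)
    · rw [Finset.card_erase_of_mem hi]
      exact Nat.sub_eq_of_eq_add hk
    · intro e he h
      rcases Finset.mem_insert.1 he with rfl | he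
      · exact Finset.notMem_erase _ _ h
      · exact hAS e he (Finset.mem_of_mem_erase h)
    · exact fun h => h _ (Finset.mem_insert_self _ _) rfl
  · rintro ⟨⟨A, S⟩, i⟩ h ⟨⟨A', S'⟩, i'⟩ h' heq
    obtain ⟨h, hi⟩ := Finset.mem_sigma.1 h
    obtain ⟨h', hi'⟩ := Finset.mem_sigma.1 h'
    obtain ⟨hA, -, -, -⟩ := mem_states.1 h
    obtain ⟨hA', -, -, -⟩ := mem_states.1 h'
    obtain ⟨heq, heqS⟩ := Prod.mk.inj heq
    dsimp only at hA hA' hi hi' heq heqS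
    have hn : ∀ j, (j, n + 1) ∉ A := fun j hj => by simpa using hA.le _ hj
    have hn' : ∀ j, (j, n + 1) ∉ A' := fun j hj => by simpa using hA'.le _ hj
    obtain rfl : i = i' := by
      have := heq ▸ Finset.mem_insert_self (i, n + 1) A
      rcases Finset.mem_insert.1 this with h | h
      · exact congrArg Prod.fst h
      · exact absurd h (hn' i)
    obtain rfl : A = A' := by
      rw [← Finset.erase_insert (hn i), heq, Finset.erase_insert (hn' i)]
    obtain rfl : S = S' := by
      rw [← Finset.insert_erase hi, heqS, Finset.insert_erase hi']
    rfl
  · rintro ⟨A, S⟩ h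
    obtain ⟨h, hn⟩ := Finset.mem_filter.1 h
    obtain ⟨hA, hS, hk, hAS⟩ := mem_states.1 h
    push Not at hn
    obtain ⟨⟨i, j⟩, he, hj⟩ := hn
    dsimp only at hA hS hk hAS he hj
    subst hj
    have hiS : i ∉ S := hAS _ he
    have h1 : 1 ≤ i := hA.one_le _ he
    have h2 : i < n + 1 := hA.lt _ he
    -- Inverse map: reopen the arc that ends at `n + 1`.
    refine ⟨⟨(A.erase (i, n + 1), insert i S), i⟩, Finset.mem_sigma.2 ⟨mem_states.2
      ⟨isArcSet_succ_iff.1 ⟨hA.subset (Finset.erase_subset _ _), ?_⟩, ?_, ?_, ?_⟩,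
      Finset.mem_insert_self _ _⟩, ?_⟩
    · intro e he' h
      exact Finset.ne_of_mem_erase he' (hA.snd_inj _ (Finset.mem_of_mem_erase he') _ he h)
    · exact Finset.insert_subset (Finset.mem_Icc.2 (by omega)) hS
    · rw [Finset.card_insert_of_notMem hiS, hk]
    · intro e he' h
      rcases Finset.mem_insert.1 h with h | h
      · exact Finset.ne_of_mem_erase he' (hA.fst_inj _ (Finset.mem_of_mem_erase he') _ he h)
      · exact hAS e (Finset.mem_of_mem_erase he') h
    · simp [Finset.insert_erase he, Finset.erase_insert hiS]
  · rintro ⟨⟨A, S⟩, i⟩ h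
    obtain ⟨h, hi⟩ := Finset.mem_sigma.1 h
    obtain ⟨hA, hS, hk, hAS⟩ := mem_states.1 h
    dsimp only at hA hS hk hAS hi ⊢
    have hn : (i, n + 1) ∉ A := fun hj => by simpa using hA.le _ hj
    rw [weight, weight]
    dsimp only
    rw [cover_insert_left hA.le (Finset.notMem_erase i S) fun s hs =>
        (Finset.mem_Icc.1 (hS (Finset.mem_of_mem_erase hs))).2, Finset.insert_erase hi,
      Finset.card_erase_of_mem hi, Finset.card_insert_of_notMem hn, hk, Nat.add_sub_cancel]
    ring

end SetPartition

/-- For `k = 0` the factor `q ^ (k - 1)` is multiplied by `k = 0`, so the first denominator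
is `1 - z`. -/
theorem mainTheorem9 {R : Type*} [CommRing R] (v q : R) :
    JFraction.HasJFraction (PowerSeries.mk fun n => SetPartition.E n v q)
      (fun k => 1 + (k : R) * q ^ (k - 1) * v)
      (fun k => ((k : R) + 1) * q ^ k * v) := by
  simp only [SetPartition.E_eq_total]
  refine JFraction.hasJFraction_of_recurrence _ _ (fun n k => SetPartition.total v q n n k)
    (SetPartition.total_zero v q) (SetPartition.total_zero_succ v q) (fun n => ?_) fun n k => ?_
  · rw [SetPartition.total_succ_zero, SetPartition.total_succ_left]
    push_cast
    ring
  -- The level weight collects two cases: neither closing nor opening (weight 1), and closing one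
  -- arc then opening another.
  · rw [SetPartition.total_succ_succ, SetPartition.total_succ_left, SetPartition.total_succ_left,
      Nat.add_sub_cancel]
    push_cast
    ring
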